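/- A (commutative) residuated lattice (RL) is an algebra $\mathbf A=\langle A;\cdot,\to,\wedge,\vee,e\rangle$ such that $\langle A;\cdot,e\rangle$ is a commutative monoid, $\langle A;\wedge,\vee\rangle$ is a lattice, and $x\cdot y\leqslant z \iff y\leqslant x\to z$ for all $x,y,z\in A$. It is idempotent if $x\cdot x=x$ for all $x$, totally ordered if its lattice order is total, simple if it has exactly two congruences, and negatively generated if it is generated, as an algebra, by $\{a\in A: a\leqslant e\}$. A deductive filter of $\mathbf A$ is a lattice filter that is also a submonoid of $\langle A;\cdot,e\rangle$; it is prime if its complement in $A$ is closed under $\vee$. An RL has finite depth if its poset of prime deductive filters, ordered by inclusion, contains no infinite strictly descending chain. Let $\mathcal S$ be the class of all simple totally ordered idempotent RLs, and let $\mathbb V(\mathcal S)=\mathbb{HSP}(\mathcal S)$ be the variety that it generates. Theorem. (1) Epimorphisms are surjective in $\mathbb V(\mathcal S)$: if $\mathbf A,\mathbf B\in\mathbb V(\mathcal S)$ and $f\colon\mathbf A\to\mathbf B$ is a homomorphism such that, for all $\mathbf C\in\mathbb V(\mathcal S)$ and all homomorphisms $g,h\colon\mathbf B\to\mathbf C$,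 $g\circ f=h\circ f$ implies $g=h$, then $f$ is surjective. (2) $\mathbb V(\mathcal S)$ has finite depth, i.e., every member of $\mathbb V(\mathcal S)$ has finite depth. (3) Some member of $\mathbb V(\mathcal S)$ is not negatively generated. -/

import Mathlib

universe u v w

/-- A (commutative) residuated lattice: a lattice and a commutative monoid (whose product is
fusion and whose unit `1` is the neutral element `e`) with a residual `res x y`, written `x → y`,
that satisfies the law of residuation. -/
class ResLattice (A : Type u) extends Lattice A, CommMonoid A where
  res : A → A → A
  mul_le_iff : ∀ x y z : A, x * y ≤ z ↔ y ≤ res x z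

namespace ResLattice

/-- The direct product of residuated lattices, with pointwise operations. -/
instance instPi {ι : Type v} (B : ι → Type w) [∀ i, ResLattice (B i)] :
    ResLattice (∀ i, B i) where
  res x y := fun i => res (x i) (y i)
  mul_le_iff x y z := forall_congr' fun i => mul_le_iff (x i) (y i) (z i)

/-- Homomorphisms of residuated lattices: maps that preserve all five basic operations. -/
structure Hom (A : Type u) (B : Type v) [ResLattice A] [ResLattice B] where
  toFun : A → B
  map_mul : ∀ x y, toFun (x * y) = toFun x * toFun y
  map_res : ∀ x y, toFun (res x y) = res (toFun x) (toFun y)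
  map_inf : ∀ x y, toFun (x ⊓ y) = toFun x ⊓ toFun y
  map_sup : ∀ x y, toFun (x ⊔ y) = toFun x ⊔ toFun y
  map_one : toFun 1 = 1

section Algebra

variable (A : Type u) [ResLattice A]

/-- A congruence: an equivalence relation compatible with all the basic operations. -/
structure IsCongruence (θ : Setoid A) : Prop where
  mul : ∀ x x' y y', θ x x' → θ y y' → θ (x * y) (x' * y')
  res : ∀ x x' y y', θ x x' → θ y y' → θ (res x y) (res x' y')
  inf : ∀ x x' y y', θ x x' → θ y y' → θ (x ⊓ y) (x' ⊓ y')
  sup : ∀ x x' y y', θ x x' → θ y y' → θ (x ⊔ y) (x' ⊔ y')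

/-- `A` is simple: it has exactly two congruences. -/
def IsSimple : Prop := {θ : Setoid A | IsCongruence A θ}.encard = 2

/-- `A` is totally ordered. -/
def IsTotallyOrdered : Prop := ∀ x y : A, x ≤ y ∨ y ≤ x

/-- `A` is idempotent. -/
def IsIdempotent : Prop := ∀ x : A, x * x = x

/-- A subuniverse: a subset closed under all the basic operations. -/
structure IsSubuniverse (X : Set A) : Prop where
  one_mem : (1 : A) ∈ X
  mul_mem : ∀ x ∈ X, ∀ y ∈ X, x * y ∈ X
  res_mem : ∀ x ∈ X, ∀ y ∈ X, res x y ∈ X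
  inf_mem : ∀ x ∈ X, ∀ y ∈ X, x ⊓ y ∈ X
  sup_mem : ∀ x ∈ X, ∀ y ∈ X, x ⊔ y ∈ X

/-- The subuniverse generated by `X`. -/
def generated (X : Set A) : Set A := ⋂₀ {Y : Set A | IsSubuniverse A Y ∧ X ⊆ Y}

/-- `A` is negatively generated: it is generated by the set of all lower bounds of `e`. -/
def IsNegativelyGenerated : Prop := generated A {a : A | a ≤ 1} = Set.univ

/-- A deductive filter: a lattice filter that is also a submonoid. -/
structure IsDeductiveFilter (F : Set A) : Prop where
  one_mem : (1 : A) ∈ F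
  mul_mem : ∀ x ∈ F, ∀ y ∈ F, x * y ∈ F
  inf_mem : ∀ x ∈ F, ∀ y ∈ F, x ⊓ y ∈ F
  upward : ∀ x ∈ F, ∀ y, x ≤ y → y ∈ F

/-- A filter is prime if its complement is closed under joins
(in particular, `A` itself is allowed). -/
def IsPrimeDeductiveFilter (F : Set A) : Prop :=
  IsDeductiveFilter A F ∧ ∀ x ∉ F, ∀ y ∉ F, x ⊔ y ∉ F

/-- `A` has infinite depth: its poset of prime deductive filters, ordered by inclusion,
contains an infinite (strictly) descending chain. -/
def HasInfiniteDepth : Prop :=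
  ∃ F : ℕ → Set A, (∀ n, IsPrimeDeductiveFilter A (F n)) ∧ ∀ n, F (n + 1) ⊂ F n

/-- `A` has finite depth. -/
def HasFiniteDepth : Prop := ¬ HasInfiniteDepth A

end Algebra

/-- The type of all residuated lattices (with universe of discourse `Type u`). -/
structure Alg : Type (u + 1) where
  carrier : Type u
  [str : ResLattice carrier]

attribute [instance] Alg.str

/-- Closure under homomorphic images. -/
def opH (K : Set Alg.{u}) : Set Alg.{u} :=
  {A | ∃ B ∈ K, ∃ f : Hom B.carrier A.carrier, Function.Surjective f.toFun}

/-- Closure under (isomorphic copies of) subalgebras. -/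
def opS (K : Set Alg.{u}) : Set Alg.{u} :=
  {A | ∃ B ∈ K, ∃ f : Hom A.carrier B.carrier, Function.Injective f.toFun}

/-- Closure under (isomorphic copies of) direct products; the empty product is allowed. -/
def opP (K : Set Alg.{u}) : Set Alg.{u} :=
  {A | ∃ (ι : Type u) (B : ι → Alg.{u}), (∀ i, B i ∈ K) ∧
    ∃ f : Hom A.carrier (∀ i, (B i).carrier), Function.Bijective f.toFun}

/-- The variety generated by a class `K`, i.e. `HSP K`. -/
def variety (K : Set Alg.{u}) : Set Alg.{u} := opH (opS (opP K))

/-- `f : A → B` is a `K`-epimorphism (for `A`, `B` in `K`): it is right-cancellable among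
homomorphisms from `B` into members of `K`. -/
def IsEpiIn (K : Set Alg.{u}) {A B : Alg.{u}} (f : Hom A.carrier B.carrier) : Prop :=
  ∀ C ∈ K, ∀ g h : Hom B.carrier C.carrier, g.toFun ∘ f.toFun = h.toFun ∘ f.toFun → g = h

/-- `K` has surjective epimorphisms (the ES property). -/
def HasSurjectiveEpis (K : Set Alg.{u}) : Prop :=
  ∀ A ∈ K, ∀ B ∈ K, ∀ f : Hom A.carrier B.carrier, IsEpiIn K f → Function.Surjective f.toFun

/-- The class of all simple totally ordered idempotent residuated lattices. -/
def simpleIdempotentChains : Set Alg.{u} :=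
  {A | IsSimple A.carrier ∧ IsTotallyOrdered A.carrier ∧ IsIdempotent A.carrier}

end ResLattice

/-! All of `variety simpleIdempotentChains` satisfies the four identities of
`IsSemisimpleSemilinear`. They make the quotient by a prime filter a rigid chain
(`IsPrimeDeductiveFilter.isRigidChain`): strictly below the unit there is at most the least element,
so the order, the unit and the bounds determine everything. Only the whole algebra lies strictly
above a prime filter, hence (2).

For (1), a proper subalgebra R of B must be separated from B by two homomorphisms agreeing on R
(`IsSeparated.of_notMem`). The main tool is doubling: if R misses a point of a nontrivial prime
quotient to which it supplies the bounds, that point can be doubled, and the chain embeds in two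
ways (`IsRigidChain.exists_doubling`). If R contains all negative elements and b is not in R, some
prime filter keeps b apart from R, and doubling applies. If a negative c is missing, there are
primes F₁, F₂ with the same trace on R, c lying only in F₂ (`exists_primes_inter_eq`). When R has
only trivial trace, the quotient map by F₁ is compared with the constant map; when R covers B/F₂,
the quotient map by F₁ is compared with a map B → B/F₂ → B/F₁; otherwise a point of B/F₂ is doubled.

For (3), a four-element chain suffices. -/

namespace ResLattice

/-! ### Arithmetic of residuation. -/

section Basic

variable {A : Type u} [ResLattice A]

theorem mul_le_mul_left_mono {x y : A} (z : A) (h : x ≤ y) : z * x ≤ z * y :=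
  (mul_le_iff _ _ _).2 (h.trans ((mul_le_iff _ _ _).1 le_rfl))

theorem mul_mono {x x' y y' : A} (h : x ≤ x') (h' : y ≤ y') : x * y ≤ x' * y' := by
  refine (mul_le_mul_left_mono x h').trans ?_
  rw [mul_comm x, mul_comm x']
  exact mul_le_mul_left_mono y' h

theorem mul_res_le (x y : A) : x * res x y ≤ y := (mul_le_iff _ _ _).2 le_rfl

theorem le_res_iff {x y z : A} : y ≤ res x z ↔ x * y ≤ z := (mul_le_iff x y z).symm

theorem one_le_res {x y : A} : 1 ≤ res x y ↔ x ≤ y := by rw [le_res_iff, mul_one]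

theorem one_res (x : A) : res 1 x = x :=
  le_antisymm (by simpa using mul_res_le 1 x) (by rw [le_res_iff, one_mul])

theorem res_mono {x x' y y' : A} (h : x' ≤ x) (h' : y ≤ y') : res x y ≤ res x' y' :=
  le_res_iff.2 ((mul_mono h le_rfl).trans ((mul_res_le x y).trans h'))

theorem mul_le_of_le_one_left {x : A} (y : A) (h : x ≤ 1) : x * y ≤ y := by
  simpa using mul_mono h (le_refl y)

theorem mul_le_of_le_one_right (x : A) {y : A} (h : y ≤ 1) : x * y ≤ x := by
  simpa using mul_mono (le_refl x) h

theorem mul_sup (x y z : A) : x * (y ⊔ z) = x * y ⊔ x * z := by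
  apply le_antisymm
  · rw [← le_res_iff]
    exact sup_le (le_res_iff.2 le_sup_left) (le_res_iff.2 le_sup_right)
  · exact sup_le (mul_mono le_rfl le_sup_left) (mul_mono le_rfl le_sup_right)

theorem sup_mul (x y z : A) : (y ⊔ z) * x = y * x ⊔ z * x := by
  simp only [mul_comm _ x, mul_sup]

theorem res_trans (x y z : A) : res x y * res y z ≤ res x z := by
  rw [le_res_iff, ← mul_assoc]
  exact (mul_mono (mul_res_le x y) le_rfl).trans (mul_res_le y z)

end Basic

/-! ### Homomorphisms -/

/-- Composition of homomorphisms. -/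
def Hom.comp {A : Type u} {B : Type v} {C : Type w} [ResLattice A] [ResLattice B] [ResLattice C]
    (g : Hom B C) (f : Hom A B) : Hom A C where
  toFun x := g.toFun (f.toFun x)
  map_mul x y := by rw [f.map_mul, g.map_mul]
  map_res x y := by rw [f.map_res, g.map_res]
  map_inf x y := by rw [f.map_inf, g.map_inf]
  map_sup x y := by rw [f.map_sup, g.map_sup]
  map_one := by rw [f.map_one, g.map_one]

/-- The identity homomorphism. -/
def Hom.id (A : Type u) [ResLattice A] : Hom A A :=
  ⟨fun x => x, fun _ _ => rfl, fun _ _ => rfl, fun _ _ => rfl, fun _ _ => rfl, rfl⟩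

/-- The homomorphism that is constantly `1`. -/
def Hom.const (A : Type u) (B : Type v) [ResLattice A] [ResLattice B] : Hom A B where
  toFun _ := 1
  map_mul _ _ := (mul_one 1).symm
  map_res _ _ := (one_res 1).symm
  map_inf _ _ := (inf_idem 1).symm
  map_sup _ _ := (sup_idem 1).symm
  map_one := rfl

theorem Hom.isSubuniverse_range {A : Type u} {B : Type v} [ResLattice A] [ResLattice B]
    (f : Hom A B) : IsSubuniverse B (Set.range f.toFun) where
  one_mem := ⟨1, f.map_one⟩
  mul_mem := by rintro _ ⟨x, rfl⟩ _ ⟨y, rfl⟩; exact ⟨_, f.map_mul x y⟩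
  res_mem := by rintro _ ⟨x, rfl⟩ _ ⟨y, rfl⟩; exact ⟨_, f.map_res x y⟩
  inf_mem := by rintro _ ⟨x, rfl⟩ _ ⟨y, rfl⟩; exact ⟨_, f.map_inf x y⟩
  sup_mem := by rintro _ ⟨x, rfl⟩ _ ⟨y, rfl⟩; exact ⟨_, f.map_sup x y⟩

theorem subset_variety (K : Set Alg.{u}) : K ⊆ variety K := by
  intro A hA
  refine ⟨A, ⟨A, ⟨PUnit, fun _ => A, fun _ => hA, ⟨fun x _ => x, fun _ _ => rfl, fun _ _ => rfl,
    fun _ _ => rfl, fun _ _ => rfl, rfl⟩, ?_, ?_⟩, Hom.id _, fun _ _ h => h⟩, Hom.id _,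
    fun x => ⟨x, rfl⟩⟩
  · intro x y h
    exact congrFun h PUnit.unit
  · intro x
    exact ⟨x PUnit.unit, rfl⟩

theorem variety_of_surjective {K : Set Alg.{u}} {A B : Alg.{u}} (hA : A ∈ variety K)
    (f : Hom A.carrier B.carrier) (hf : Function.Surjective f.toFun) : B ∈ variety K := by
  obtain ⟨D, hD, g, hg⟩ := hA
  exact ⟨D, hD, f.comp g, hf.comp hg⟩

/-! ### Identities of the variety -/

/-- The identities of semisimple idempotent semilinear residuated lattices. -/
structure IsSemisimpleSemilinear (A : Type u) [ResLattice A] : Prop where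
  idem : ∀ x : A, x * x = x
  inf_sup : ∀ x y z : A, x ⊓ (y ⊔ z) = x ⊓ y ⊔ x ⊓ z
  prelin : ∀ x y : A, 1 ⊓ (res x y ⊔ res y x) = 1
  -- In a chain this says that an element strictly below the unit lies below every `y`.
  compl : ∀ x y : A, 1 ⊓ ((x ⊓ 1) ⊔ res (x ⊓ 1) y) = 1

theorem IsSemisimpleSemilinear.of_surjective {A : Type u} {B : Type v} [ResLattice A]
    [ResLattice B] (hA : IsSemisimpleSemilinear A) (f : Hom A B)
    (hf : Function.Surjective f.toFun) : IsSemisimpleSemilinear B where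
  idem x := by
    obtain ⟨x, rfl⟩ := hf x
    rw [← f.map_mul, hA.idem]
  inf_sup x y z := by
    obtain ⟨x, rfl⟩ := hf x
    obtain ⟨y, rfl⟩ := hf y
    obtain ⟨z, rfl⟩ := hf z
    simp only [← f.map_inf, ← f.map_sup, hA.inf_sup]
  prelin x y := by
    obtain ⟨x, rfl⟩ := hf x
    obtain ⟨y, rfl⟩ := hf y
    simp only [← f.map_inf, ← f.map_sup, ← f.map_res, ← f.map_one, hA.prelin]
  compl x y := by
    obtain ⟨x, rfl⟩ := hf x
    obtain ⟨y, rfl⟩ := hf y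
    simp only [← f.map_inf, ← f.map_sup, ← f.map_res, ← f.map_one, hA.compl]

theorem IsSemisimpleSemilinear.of_injective {A : Type u} {B : Type v} [ResLattice A]
    [ResLattice B] (hB : IsSemisimpleSemilinear B) (f : Hom A B)
    (hf : Function.Injective f.toFun) : IsSemisimpleSemilinear A where
  idem x := hf (by rw [f.map_mul, hB.idem])
  inf_sup x y z := hf (by simp only [f.map_inf, f.map_sup, hB.inf_sup])
  prelin x y := hf (by simp only [f.map_inf, f.map_sup, f.map_res, f.map_one, hB.prelin])
  compl x y := hf (by simp only [f.map_inf, f.map_sup, f.map_res, f.map_one, hB.compl])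

theorem IsSemisimpleSemilinear.pi {ι : Type v} (B : ι → Type w) [∀ i, ResLattice (B i)]
    (h : ∀ i, IsSemisimpleSemilinear (B i)) : IsSemisimpleSemilinear (∀ i, B i) where
  idem x := funext fun i => (h i).idem (x i)
  inf_sup x y z := funext fun i => (h i).inf_sup (x i) (y i) (z i)
  prelin x y := funext fun i => (h i).prelin (x i) (y i)
  compl x y := funext fun i => (h i).compl (x i) (y i)

theorem IsSemisimpleSemilinear.of_mem_variety {K : Set Alg.{u}}
    (hK : ∀ A ∈ K, IsSemisimpleSemilinear A.carrier) {A : Alg.{u}} (hA : A ∈ variety K) :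
    IsSemisimpleSemilinear A.carrier := by
  obtain ⟨B, ⟨C, ⟨ι, D, hD, f, hf⟩, g, hg⟩, k, hk⟩ := hA
  exact (((IsSemisimpleSemilinear.pi _ fun i => hK _ (hD i)).of_injective f hf.1).of_injective
    g hg).of_surjective k hk

/-! ### Quotients by deductive filters -/

section Quotient

variable {A : Type u} [ResLattice A] {F : Set A}

theorem IsDeductiveFilter.inf_mem_iff (hF : IsDeductiveFilter A F) {x y : A} :
    x ⊓ y ∈ F ↔ x ∈ F ∧ y ∈ F :=
  ⟨fun h => ⟨hF.upward _ h _ inf_le_left, hF.upward _ h _ inf_le_right⟩,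
    fun h => hF.inf_mem _ h.1 _ h.2⟩

theorem IsDeductiveFilter.mem_of_one_le (hF : IsDeductiveFilter A F) {x : A} (h : 1 ≤ x) :
    x ∈ F :=
  hF.upward _ hF.one_mem _ h

theorem IsDeductiveFilter.res_trans (hF : IsDeductiveFilter A F) {x y z : A}
    (h : res x y ∈ F) (h' : res y z ∈ F) : res x z ∈ F :=
  hF.upward _ (hF.mul_mem _ h _ h') _ (ResLattice.res_trans x y z)

theorem IsDeductiveFilter.res_refl (hF : IsDeductiveFilter A F) (x : A) : res x x ∈ F :=
  hF.mem_of_one_le (one_le_res.2 le_rfl)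

/-- The congruence of a deductive filter. -/
def IsDeductiveFilter.setoid (hF : IsDeductiveFilter A F) : Setoid A where
  r x y := res x y ∈ F ∧ res y x ∈ F
  iseqv :=
    { refl := fun x => ⟨hF.res_refl x, hF.res_refl x⟩
      symm := fun h => ⟨h.2, h.1⟩
      trans := fun h h' => ⟨hF.res_trans h.1 h'.1, hF.res_trans h'.2 h.2⟩ }

theorem IsDeductiveFilter.res_mul_mem (hF : IsDeductiveFilter A F) {x x' y y' : A}
    (h : res x x' ∈ F) (h' : res y y' ∈ F) : res (x * y) (x' * y') ∈ F := by
  refine hF.upward _ (hF.mul_mem _ h _ h') _ ?_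
  rw [le_res_iff, mul_mul_mul_comm]
  exact mul_mono (mul_res_le _ _) (mul_res_le _ _)

theorem IsDeductiveFilter.res_res_mem (hF : IsDeductiveFilter A F) {x x' y y' : A}
    (h : res x' x ∈ F) (h' : res y y' ∈ F) : res (res x y) (res x' y') ∈ F := by
  refine hF.upward _ (hF.mul_mem _ h _ h') _ ?_
  rw [le_res_iff, le_res_iff]
  calc x' * (res x y * (res x' x * res y y'))
      = (x' * res x' x) * (res x y * res y y') := by ac_rfl
    _ ≤ x * (res x y * res y y') := mul_mono (mul_res_le _ _) le_rfl
    _ = (x * res x y) * res y y' := by ac_rfl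
    _ ≤ y * res y y' := mul_mono (mul_res_le _ _) le_rfl
    _ ≤ y' := mul_res_le _ _

theorem IsDeductiveFilter.res_inf_mem (hF : IsDeductiveFilter A F) {x y z : A}
    (h : res x y ∈ F) (h' : res x z ∈ F) : res x (y ⊓ z) ∈ F := by
  refine hF.upward _ (hF.inf_mem _ h _ h') _ ?_
  rw [le_res_iff]
  exact le_inf (le_res_iff.1 inf_le_left) (le_res_iff.1 inf_le_right)

theorem IsDeductiveFilter.sup_res_mem (hF : IsDeductiveFilter A F) {x y z : A}
    (h : res x z ∈ F) (h' : res y z ∈ F) : res (x ⊔ y) z ∈ F := by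
  refine hF.upward _ (hF.inf_mem _ h _ h') _ ?_
  rw [le_res_iff, sup_mul]
  exact sup_le (le_res_iff.1 inf_le_left) (le_res_iff.1 inf_le_right)

theorem IsDeductiveFilter.res_mem_of_le_left (hF : IsDeductiveFilter A F) {x x' y : A}
    (h : res x y ∈ F) (hx : x' ≤ x) : res x' y ∈ F :=
  hF.upward _ h _ (res_mono hx le_rfl)

theorem IsDeductiveFilter.res_mem_of_le_right (hF : IsDeductiveFilter A F) {x y y' : A}
    (h : res x y ∈ F) (hy : y ≤ y') : res x y' ∈ F :=
  hF.upward _ h _ (res_mono le_rfl hy)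

theorem IsDeductiveFilter.res_inf_inf_mem (hF : IsDeductiveFilter A F) {x x' y y' : A}
    (h : res x x' ∈ F) (h' : res y y' ∈ F) : res (x ⊓ y) (x' ⊓ y') ∈ F :=
  hF.res_inf_mem (hF.res_mem_of_le_left h inf_le_left) (hF.res_mem_of_le_left h' inf_le_right)

theorem IsDeductiveFilter.res_sup_sup_mem (hF : IsDeductiveFilter A F) {x x' y y' : A}
    (h : res x x' ∈ F) (h' : res y y' ∈ F) : res (x ⊔ y) (x' ⊔ y') ∈ F :=
  hF.sup_res_mem (hF.res_mem_of_le_right h le_sup_left) (hF.res_mem_of_le_right h' le_sup_right)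

theorem IsDeductiveFilter.isCongruence (hF : IsDeductiveFilter A F) :
    IsCongruence A hF.setoid where
  mul _ _ _ _ h h' := ⟨hF.res_mul_mem h.1 h'.1, hF.res_mul_mem h.2 h'.2⟩
  res _ _ _ _ h h' := ⟨hF.res_res_mem h.2 h'.1, hF.res_res_mem h.1 h'.2⟩
  inf _ _ _ _ h h' := ⟨hF.res_inf_inf_mem h.1 h'.1, hF.res_inf_inf_mem h.2 h'.2⟩
  sup _ _ _ _ h h' := ⟨hF.res_sup_sup_mem h.1 h'.1, hF.res_sup_sup_mem h.2 h'.2⟩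

/-- The quotient of a residuated lattice by a deductive filter. -/
def FilterQuotient (hF : IsDeductiveFilter A F) : Type u := Quotient hF.setoid

/-- The class of an element in the quotient by a deductive filter. -/
def FilterQuotient.mk (hF : IsDeductiveFilter A F) (x : A) : FilterQuotient hF :=
  Quotient.mk hF.setoid x

theorem FilterQuotient.mk_surjective (hF : IsDeductiveFilter A F) :
    Function.Surjective (FilterQuotient.mk hF) := Quotient.mk_surjective

theorem FilterQuotient.mk_eq_iff (hF : IsDeductiveFilter A F) {x y : A} :
    FilterQuotient.mk hF x = FilterQuotient.mk hF y ↔ res x y ∈ F ∧ res y x ∈ F :=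
  ⟨fun h => Quotient.exact h, fun h => Quotient.sound (s := hF.setoid) h⟩

instance (hF : IsDeductiveFilter A F) : ResLattice (FilterQuotient hF) where
  le := Quotient.lift₂ (s₁ := hF.setoid) (s₂ := hF.setoid) (fun x y => res x y ∈ F)
    fun _ _ _ _ h h' => propext
      ⟨fun k => hF.res_trans (hF.res_trans h.2 k) h'.1,
        fun k => hF.res_trans (hF.res_trans h.1 k) h'.2⟩
  le_refl := by
    rintro ⟨x⟩
    exact hF.res_refl x
  le_trans := by
    rintro ⟨x⟩ ⟨y⟩ ⟨z⟩ h h'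
    exact hF.res_trans h h'
  le_antisymm := by
    rintro ⟨x⟩ ⟨y⟩ h h'
    exact Quotient.sound (s := hF.setoid) ⟨h, h'⟩
  sup := Quotient.map₂ (sa := hF.setoid) (sb := hF.setoid) (sc := hF.setoid) (· ⊔ ·)
    fun _ _ h _ _ h' => hF.isCongruence.sup _ _ _ _ h h'
  le_sup_left := by
    rintro ⟨x⟩ ⟨y⟩
    exact hF.mem_of_one_le (one_le_res.2 le_sup_left)
  le_sup_right := by
    rintro ⟨x⟩ ⟨y⟩
    exact hF.mem_of_one_le (one_le_res.2 le_sup_right)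
  sup_le := by
    rintro ⟨x⟩ ⟨y⟩ ⟨z⟩ h h'
    exact hF.sup_res_mem h h'
  inf := Quotient.map₂ (sa := hF.setoid) (sb := hF.setoid) (sc := hF.setoid) (· ⊓ ·)
    fun _ _ h _ _ h' => hF.isCongruence.inf _ _ _ _ h h'
  inf_le_left := by
    rintro ⟨x⟩ ⟨y⟩
    exact hF.mem_of_one_le (one_le_res.2 inf_le_left)
  inf_le_right := by
    rintro ⟨x⟩ ⟨y⟩
    exact hF.mem_of_one_le (one_le_res.2 inf_le_right)
  le_inf := by
    rintro ⟨x⟩ ⟨y⟩ ⟨z⟩ h h'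
    exact hF.res_inf_mem h h'
  mul := Quotient.map₂ (sa := hF.setoid) (sb := hF.setoid) (sc := hF.setoid) (· * ·)
    fun _ _ h _ _ h' => hF.isCongruence.mul _ _ _ _ h h'
  one := FilterQuotient.mk hF 1
  mul_assoc := by
    rintro ⟨x⟩ ⟨y⟩ ⟨z⟩
    exact congrArg (FilterQuotient.mk hF) (mul_assoc x y z)
  one_mul := by
    rintro ⟨x⟩
    exact congrArg (FilterQuotient.mk hF) (one_mul x)
  mul_one := by
    rintro ⟨x⟩
    exact congrArg (FilterQuotient.mk hF) (mul_one x)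
  mul_comm := by
    rintro ⟨x⟩ ⟨y⟩
    exact congrArg (FilterQuotient.mk hF) (mul_comm x y)
  res := Quotient.map₂ (sa := hF.setoid) (sb := hF.setoid) (sc := hF.setoid) res
    fun _ _ h _ _ h' => hF.isCongruence.res _ _ _ _ h h'
  mul_le_iff := by
    rintro ⟨x⟩ ⟨y⟩ ⟨z⟩
    -- With this exchange law, both sides of residuation in the quotient become the same membership
    -- in `F`.
    have h : res (x * y) z = res y (res x z) := by
      apply le_antisymm
      · rw [le_res_iff, le_res_iff, ← mul_assoc]
        exact mul_res_le _ _
      · rw [le_res_iff, mul_assoc, ← le_res_iff]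
        exact mul_res_le _ _
    change res (x * y) z ∈ F ↔ res y (res x z) ∈ F
    rw [h]

theorem FilterQuotient.mk_le_iff (hF : IsDeductiveFilter A F) {x y : A} :
    FilterQuotient.mk hF x ≤ FilterQuotient.mk hF y ↔ res x y ∈ F := Iff.rfl

/-- The canonical homomorphism onto the quotient by a deductive filter. -/
def FilterQuotient.mkHom (hF : IsDeductiveFilter A F) : Hom A (FilterQuotient hF) where
  toFun := FilterQuotient.mk hF
  map_mul _ _ := rfl
  map_res _ _ := rfl
  map_inf _ _ := rfl
  map_sup _ _ := rfl
  map_one := rfl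

theorem FilterQuotient.mk_eq_one_iff (hF : IsDeductiveFilter A F) {x : A} :
    FilterQuotient.mk hF x = 1 ↔ x ∈ F ∧ res x 1 ∈ F := by
  rw [← (FilterQuotient.mkHom hF).map_one]
  change FilterQuotient.mk hF x = FilterQuotient.mk hF 1 ↔ _
  rw [FilterQuotient.mk_eq_iff, one_res, and_comm]

theorem FilterQuotient.mk_eq_one_iff_of_le (hF : IsDeductiveFilter A F) {x : A} (hx : x ≤ 1) :
    FilterQuotient.mk hF x = 1 ↔ x ∈ F := by
  rw [FilterQuotient.mk_eq_one_iff]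
  exact and_iff_left (hF.mem_of_one_le (one_le_res.2 hx))

end Quotient

/-! ### Chains whose only element strictly below the unit is the least element -/

/-- Idempotent chains in which every element strictly below the unit is a least element. -/
structure IsRigidChain (A : Type u) [ResLattice A] : Prop where
  total : IsTotallyOrdered A
  idem : IsIdempotent A
  least : ∀ x : A, x < 1 → ∀ y, x ≤ y

section RigidChain

variable {A : Type u} [ResLattice A]

/-- By idempotence the up-set of `x < 1` is a deductive filter. Its congruence identifies `x` with
`1`, so simplicity makes it total; relating `1` to `y` then means `x ≤ res 1 y = y`. -/
theorem IsRigidChain.of_simple (hs : IsSimple A) (ht : IsTotallyOrdered A)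
    (hi : IsIdempotent A) : IsRigidChain A := by
  refine ⟨ht, hi, fun x hx y => ?_⟩
  have hF : IsDeductiveFilter A {z | x ≤ z} :=
    { one_mem := hx.le
      mul_mem := fun a ha b hb => (hi x).ge.trans (mul_mono ha hb)
      inf_mem := fun a ha b hb => le_inf ha hb
      upward := fun a ha b hb => le_trans ha hb }
  have hx1 : hF.setoid x 1 :=
    ⟨hx.le.trans (one_le_res.2 hx.le), (one_res x).ge⟩
  have hbot : IsCongruence A ⊥ := by
    constructor <;> (rintro x x' y y' rfl rfl; rfl)
  have htop : IsCongruence A ⊤ := by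
    constructor <;> (intros; trivial)
  have hne : (⊥ : Setoid A) ≠ ⊤ := by
    intro h
    have : (⊥ : Setoid A) x 1 := by rw [h]; trivial
    exact hx.ne this
  have hb : hF.setoid ≠ ⊥ := by
    intro h
    rw [h] at hx1
    exact hx.ne hx1
  have hset : hF.setoid = ⊤ := by
    by_contra hT
    have hsub : ({hF.setoid, ⊥, ⊤} : Set (Setoid A)) ⊆ {θ | IsCongruence A θ} := by
      rintro θ (rfl | rfl | rfl)
      exacts [hF.isCongruence, hbot, htop]
    have hle := Set.encard_le_encard hsub
    have h3 : ({hF.setoid, ⊥, ⊤} : Set (Setoid A)).encard = 3 :=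
      Set.encard_eq_three.2 ⟨_, _, _, hb, hT, hne, rfl⟩
    rw [h3, show Set.encard _ = 2 from hs] at hle
    exact absurd hle (by decide)
  have : hF.setoid 1 y := by rw [hset]; trivial
  simpa [one_res] using this.1

theorem IsRigidChain.isSemisimpleSemilinear (h : IsRigidChain A) : IsSemisimpleSemilinear A where
  idem := h.idem
  inf_sup x y z := by
    apply le_antisymm
    · rcases h.total y z with hyz | hyz
      · rw [sup_eq_right.2 hyz]
        exact le_sup_right
      · rw [sup_eq_left.2 hyz]
        exact le_sup_left
    · exact le_inf (sup_le inf_le_left inf_le_left) (sup_le_sup inf_le_right inf_le_right)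
  prelin x y := by
    rw [inf_eq_left]
    rcases h.total x y with hxy | hxy
    · exact (one_le_res.2 hxy).trans le_sup_left
    · exact (one_le_res.2 hxy).trans le_sup_right
  compl x y := by
    rw [inf_eq_left]
    rcases (inf_le_right : x ⊓ 1 ≤ 1).eq_or_lt with hx | hx
    · exact hx.ge.trans le_sup_left
    · exact (one_le_res.2 (h.least _ hx y)).trans le_sup_right

theorem IsRigidChain.not_le_iff_lt (h : IsRigidChain A) {x y : A} : ¬ x ≤ y ↔ y < x :=
  ⟨fun hn => lt_of_le_not_ge ((h.total x y).resolve_left hn) hn, fun hl => hl.not_ge⟩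

theorem IsRigidChain.mul_of_lt (h : IsRigidChain A) {x : A} (hx : x < 1) (y : A) : x * y = x :=
  le_antisymm (by rw [mul_comm, mul_le_iff]; exact h.least x hx _) (h.least x hx _)

theorem IsRigidChain.mul_of_le (h : IsRigidChain A) {x y : A} (hx : 1 ≤ x) (hxy : x ≤ y) :
    x * y = y :=
  le_antisymm ((mul_mono hxy le_rfl).trans (h.idem y).le) (by simpa using mul_mono hx (le_refl y))

theorem IsRigidChain.le_res_of_lt (h : IsRigidChain A) {x : A} (hx : x < 1) (y z : A) :
    z ≤ res x y := by
  rw [le_res_iff, h.mul_of_lt hx]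
  exact h.least x hx y

theorem IsRigidChain.res_of_le (h : IsRigidChain A) {x y : A} (hx : 1 ≤ x) (hxy : x ≤ y) :
    res x y = y := by
  apply le_antisymm
  · refine le_trans ?_ (mul_res_le x y)
    simpa using mul_mono hx (le_refl (res x y))
  · rw [le_res_iff, h.mul_of_le hx hxy]

theorem IsRigidChain.res_lt_one (h : IsRigidChain A) {x y : A} (hxy : ¬ x ≤ y) :
    res x y < 1 := by
  rw [← h.not_le_iff_lt, one_le_res]
  exact hxy

/-- A map between rigid chains is a homomorphism if it reflects and preserves the order and
preserves the unit and the greatest element. -/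
def IsRigidChain.homOfOrderEmbedding {B : Type v} [ResLattice B] (hA : IsRigidChain A)
    (hB : IsRigidChain B) (φ : A → B) (hle : ∀ x y, φ x ≤ φ y ↔ x ≤ y) (hone : φ 1 = 1)
    (htop : ∀ t, (∀ z, z ≤ t) → ∀ z, z ≤ φ t) : Hom A B :=
  have hlt : ∀ x, x < 1 → φ x < 1 := fun x hx => by
    rw [← hB.not_le_iff_lt, ← hone, hle]
    exact hx.not_ge
  have hge : ∀ x, 1 ≤ x → 1 ≤ φ x := fun x hx => by rwa [← hone, hle]
  have hmul : ∀ x y, x ≤ y → φ (x * y) = φ x * φ y := fun x y hxy => by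
    by_cases hx : 1 ≤ x
    · rw [hA.mul_of_le hx hxy, hB.mul_of_le (hge x hx) ((hle _ _).2 hxy)]
    · rw [hA.not_le_iff_lt] at hx
      rw [hA.mul_of_lt hx, hB.mul_of_lt (hlt x hx)]
  { toFun := φ
    map_mul := fun x y => by
      rcases hA.total x y with h | h
      · exact hmul x y h
      · rw [mul_comm x, mul_comm (φ x)]
        exact hmul y x h
    map_res := fun x y => by
      by_cases hx : 1 ≤ x
      · by_cases hxy : x ≤ y
        · rw [hA.res_of_le hx hxy, hB.res_of_le (hge x hx) ((hle _ _).2 hxy)]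
        -- Both residuals fall strictly below the unit, so each is the least element.
        · have h1 := hB.res_lt_one (mt (hle x y).1 hxy)
          have h2 := hlt _ (hA.res_lt_one hxy)
          exact le_antisymm (hB.least _ h2 _) (hB.least _ h1 _)
      · rw [hA.not_le_iff_lt] at hx
        exact le_antisymm (hB.le_res_of_lt (hlt x hx) _ _)
          (htop _ (fun z => hA.le_res_of_lt hx y z) _)
    map_inf := fun x y => by
      rcases hA.total x y with h | h
      · rw [inf_eq_left.2 h, inf_eq_left.2 ((hle _ _).2 h)]
      · rw [inf_eq_right.2 h, inf_eq_right.2 ((hle _ _).2 h)]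
    map_sup := fun x y => by
      rcases hA.total x y with h | h
      · rw [sup_eq_right.2 h, sup_eq_right.2 ((hle _ _).2 h)]
      · rw [sup_eq_left.2 h, sup_eq_left.2 ((hle _ _).2 h)]
    map_one := hone }

/-- Identifying `x < y` identifies the least element `res y x` with `1`; multiplying by `z` then
collapses everything. The element `b` excludes the trivial algebra. -/
theorem IsRigidChain.isSimple (h : IsRigidChain A) {b : A} (hb : b < 1) : IsSimple A := by
  have key : ∀ θ : Setoid A, IsCongruence A θ → ∀ x y, θ x y → x < y → θ = ⊤ := by
    intro θ hθ x y hxy hlt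
    have h1 : θ (res y x ⊓ 1) 1 := by
      have h2 := hθ.inf _ _ _ _ (hθ.res _ _ _ _ (θ.refl y) hxy) (θ.refl 1)
      rwa [inf_eq_right.2 (one_le_res.2 le_rfl)] at h2
    have h3 := h.res_lt_one hlt.not_ge
    rw [inf_eq_left.2 h3.le] at h1
    have h4 : ∀ z, θ (res y x) z := by
      intro z
      have := hθ.mul _ _ _ _ h1 (θ.refl z)
      rwa [h.mul_of_lt h3, one_mul] at this
    ext a c
    exact ⟨fun _ => trivial, fun _ => θ.trans (θ.symm (h4 a)) (h4 c)⟩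
  refine Set.encard_eq_two.2 ⟨⊥, ⊤, ?_, ?_⟩
  · intro he
    have : (⊥ : Setoid A) b 1 := by rw [he]; trivial
    exact hb.ne this
  · ext θ
    simp only [Set.mem_ofPred_eq, Set.mem_insert_iff, Set.mem_singleton_iff]
    constructor
    · intro hθ
      by_cases he : ∀ x y, θ x y → x = y
      · left
        ext x y
        exact ⟨he x y, fun hxy => by rw [show x = y from hxy]⟩
      · right
        push Not at he
        obtain ⟨x, y, hxy, hne⟩ := he
        rcases h.total x y with hl | hl
        · exact key θ hθ x y hxy (lt_of_le_of_ne hl hne)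
        · exact key θ hθ y x (θ.symm hxy) (lt_of_le_of_ne hl hne.symm)
    · rintro (rfl | rfl)
      · constructor <;> (rintro x x' y y' rfl rfl; rfl)
      · constructor <;> (intros; trivial)

end RigidChain

/-- The rigid chain on a linear order with least element `b`, unit `e` and greatest
element `t`. -/
@[reducible] def ofLinearOrder (L : Type u) [LinearOrder L] (b e t : L) (hbe : b < e)
    (hb : ∀ x, x < e → x = b) (ht : ∀ x, x ≤ t) : ResLattice L where
  mul x y := if x < e ∨ y < e then min x y else max x y
  one := e
  mul_comm x y := by
    change (if x < e ∨ y < e then min x y else max x y) =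
      if y < e ∨ x < e then min y x else max y x
    grind
  mul_assoc x y z := by
    change (if (if x < e ∨ y < e then min x y else max x y) < e ∨ z < e
        then min (if x < e ∨ y < e then min x y else max x y) z
        else max (if x < e ∨ y < e then min x y else max x y) z) =
      if x < e ∨ (if y < e ∨ z < e then min y z else max y z) < e
        then min x (if y < e ∨ z < e then min y z else max y z)
        else max x (if y < e ∨ z < e then min y z else max y z)
    grind
  one_mul x := by
    change (if e < e ∨ x < e then min e x else max e x) = x
    grind
  mul_one x := by
    change (if x < e ∨ e < e then min x e else max x e) = x
    grind
  res x y := if x < e then t else if x ≤ y then y else b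
  mul_le_iff x y z := by
    change (if x < e ∨ y < e then min x y else max x y) ≤ z ↔
      y ≤ if x < e then t else if x ≤ z then z else b
    have hb' : b ≤ z := by
      rcases lt_or_ge z e with h | h
      · exact (hb z h).ge
      · exact hbe.le.trans h
    grind

theorem isRigidChain_ofLinearOrder (L : Type u) [LinearOrder L] (b e t : L) (hbe : b < e)
    (hb : ∀ x, x < e → x = b) (ht : ∀ x, x ≤ t) :
    let _ := ofLinearOrder L b e t hbe hb ht
    IsRigidChain L := by
  let _ := ofLinearOrder L b e t hbe hb ht
  refine ⟨fun x y => le_total x y, fun x => ?_, fun x hx y => ?_⟩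
  · change (if x < e ∨ x < e then min x x else max x x) = x
    grind
  · change x < e at hx
    rw [hb x hx]
    rcases lt_or_ge y e with h | h
    · exact (hb y h).ge
    · exact hbe.le.trans h

theorem ofLinearOrder_mem (L : Type u) [LinearOrder L] (b e t : L) (hbe : b < e)
    (hb : ∀ x, x < e → x = b) (ht : ∀ x, x ≤ t) :
    (@Alg.mk L (ofLinearOrder L b e t hbe hb ht)) ∈ simpleIdempotentChains.{u} := by
  let _ := ofLinearOrder L b e t hbe hb ht
  have h := isRigidChain_ofLinearOrder L b e t hbe hb ht
  exact ⟨h.isSimple (b := b) hbe, h.total, h.idem⟩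

theorem isSemisimpleSemilinear_of_mem_variety {A : Alg.{u}}
    (hA : A ∈ variety simpleIdempotentChains.{u}) : IsSemisimpleSemilinear A.carrier :=
  IsSemisimpleSemilinear.of_mem_variety
    (fun _ h => (IsRigidChain.of_simple h.1 h.2.1 h.2.2).isSemisimpleSemilinear) hA

/-! ### Prime deductive filters -/

section Prime

variable {A : Type u} [ResLattice A] {F : Set A}

/-- If `x` lies outside a prime filter, then every residual of `x ⊓ 1` lies in it. -/
theorem IsPrimeDeductiveFilter.res_mem (hA : IsSemisimpleSemilinear A)
    (hF : IsPrimeDeductiveFilter A F) {x : A} (hx : x ∉ F) (y : A) : res (x ⊓ 1) y ∈ F := by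
  by_contra hn
  refine hF.2 (x ⊓ 1) (fun h => hx (hF.1.inf_mem_iff.1 h).1) _ hn ?_
  exact hF.1.mem_of_one_le (inf_eq_left.1 (hA.compl x y))

/-- For `x` in `G` outside `F`, modus ponens with `x ⊓ 1` and its residuals, which all lie in `F`,
yields every element. -/
theorem IsPrimeDeductiveFilter.eq_univ_of_ssubset (hA : IsSemisimpleSemilinear A)
    (hF : IsPrimeDeductiveFilter A F) {G : Set A} (hG : IsDeductiveFilter A G) (h : F ⊂ G) :
    G = Set.univ := by
  obtain ⟨x, hxG, hxF⟩ := Set.exists_of_ssubset h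
  refine Set.eq_univ_of_forall fun y => ?_
  exact hG.upward _ (hG.mul_mem _ (hG.inf_mem _ hxG _ hG.one_mem) _ (h.1 (hF.res_mem hA hxF y))) _
    (mul_res_le _ _)

theorem IsSemisimpleSemilinear.hasFiniteDepth (hA : IsSemisimpleSemilinear A) :
    HasFiniteDepth A := by
  rintro ⟨F, hF, hlt⟩
  have h := (hF 2).eq_univ_of_ssubset hA (hF 1).1 (hlt 1)
  have h' := hlt 0
  rw [zero_add, h] at h'
  exact h'.2 (Set.subset_univ _)

theorem IsPrimeDeductiveFilter.isRigidChain (hA : IsSemisimpleSemilinear A)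
    (hF : IsPrimeDeductiveFilter A F) : IsRigidChain (FilterQuotient hF.1) := by
  refine ⟨fun x y => ?_, fun x => ?_, fun x hx y => ?_⟩
  · obtain ⟨x, rfl⟩ := FilterQuotient.mk_surjective hF.1 x
    obtain ⟨y, rfl⟩ := FilterQuotient.mk_surjective hF.1 y
    simp only [FilterQuotient.mk_le_iff]
    by_contra hn
    push Not at hn
    exact hF.2 _ hn.1 _ hn.2 (hF.1.mem_of_one_le (inf_eq_left.1 (hA.prelin x y)))
  · exact (hA.of_surjective (FilterQuotient.mkHom hF.1)
      (FilterQuotient.mk_surjective hF.1)).idem x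
  · obtain ⟨x, rfl⟩ := FilterQuotient.mk_surjective hF.1 x
    obtain ⟨y, rfl⟩ := FilterQuotient.mk_surjective hF.1 y
    have hx' : x ∉ F := by
      intro h
      refine hx.not_ge ?_
      change res 1 x ∈ F
      rwa [one_res]
    have h1 : FilterQuotient.mk hF.1 x ≤ FilterQuotient.mk hF.1 (x ⊓ 1) := le_inf le_rfl hx.le
    exact h1.trans (hF.res_mem hA hx' y)

/-- Idempotence makes a single factor `x ⊓ 1` enough; cutting `x` down by `1` keeps `F` inside. -/
theorem IsDeductiveFilter.adjoin (hA : IsSemisimpleSemilinear A) (hF : IsDeductiveFilter A F)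
    (x : A) : IsDeductiveFilter A {z | ∃ f ∈ F, f * (x ⊓ 1) ≤ z} where
  one_mem := ⟨1, hF.one_mem, by rw [one_mul]; exact inf_le_right⟩
  mul_mem := by
    rintro y ⟨f, hf, hy⟩ z ⟨g, hg, hz⟩
    refine ⟨f * g, hF.mul_mem _ hf _ hg, ?_⟩
    rw [← hA.idem (x ⊓ 1), mul_mul_mul_comm]
    exact mul_mono hy hz
  inf_mem := by
    rintro y ⟨f, hf, hy⟩ z ⟨g, hg, hz⟩
    exact ⟨f ⊓ g, hF.inf_mem _ hf _ hg, le_inf ((mul_mono inf_le_left le_rfl).trans hy)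
      ((mul_mono inf_le_right le_rfl).trans hz)⟩
  upward := by
    rintro y ⟨f, hf, hy⟩ z hz
    exact ⟨f, hf, hy.trans hz⟩

/-- The prime filter theorem. -/
theorem exists_isPrimeDeductiveFilter (hA : IsSemisimpleSemilinear A)
    (hF : IsDeductiveFilter A F) {I : Set A} (hI : ∀ x ∈ I, ∀ y ∈ I, x ⊔ y ∈ I)
    (hd : ∀ x ∈ F, x ∉ I) :
    ∃ G, IsPrimeDeductiveFilter A G ∧ F ⊆ G ∧ ∀ x ∈ G, x ∉ I := by
  obtain ⟨G, hFG, hG⟩ := zorn_subset_nonempty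
    {G : Set A | IsDeductiveFilter A G ∧ ∀ x ∈ G, x ∉ I} (by
      intro c hc hch hne
      refine ⟨⋃₀ c, ⟨?_, ?_⟩, fun s hs => Set.subset_sUnion_of_mem hs⟩
      · have hdir : ∀ x ∈ ⋃₀ c, ∀ y ∈ ⋃₀ c, ∃ s ∈ c, x ∈ s ∧ y ∈ s := by
          rintro x ⟨s, hs, hx⟩ y ⟨s', hs', hy⟩
          rcases hch.total hs hs' with h | h
          · exact ⟨s', hs', h hx, hy⟩
          · exact ⟨s, hs, hx, h hy⟩
        refine ⟨?_, ?_, ?_, ?_⟩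
        · obtain ⟨s, hs⟩ := hne
          exact ⟨s, hs, (hc hs).1.one_mem⟩
        · intro x hx y hy
          obtain ⟨s, hs, hx, hy⟩ := hdir x hx y hy
          exact ⟨s, hs, (hc hs).1.mul_mem _ hx _ hy⟩
        · intro x hx y hy
          obtain ⟨s, hs, hx, hy⟩ := hdir x hx y hy
          exact ⟨s, hs, (hc hs).1.inf_mem _ hx _ hy⟩
        · rintro x ⟨s, hs, hx⟩ y hy
          exact ⟨s, hs, (hc hs).1.upward _ hx _ hy⟩
      · rintro x ⟨s, hs, hx⟩
        exact (hc hs).2 x hx) F ⟨hF, hd⟩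
  have hGf : IsDeductiveFilter A G := hG.prop.1
  -- By maximality, adjoining `x` to `G` must meet `I`. Taking `f ≤ 1` lets it be dropped as a
  -- factor later.
  have hadj : ∀ x ∉ G, ∃ f ∈ G, f ≤ 1 ∧ ∃ i ∈ I, f * (x ⊓ 1) ≤ i := by
    intro x hx
    by_contra hn
    push Not at hn
    refine hx (hG.le_of_ge ⟨hGf.adjoin hA x, ?_⟩ ?_ ?_)
    · rintro i ⟨f, hf, hfi⟩ hi
      exact hn (f ⊓ 1) (hGf.inf_mem _ hf _ hGf.one_mem) inf_le_right i hi
        ((mul_mono inf_le_left le_rfl).trans hfi)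
    · intro g hg
      exact ⟨g, hg, mul_le_of_le_one_right g inf_le_right⟩
    · exact ⟨1, hGf.one_mem, by rw [one_mul]; exact inf_le_left⟩
  refine ⟨G, ⟨hGf, fun x hx y hy hxy => ?_⟩, hFG, hG.prop.2⟩
  obtain ⟨f, hf, hf1, i, hi, hfi⟩ := hadj x hx
  obtain ⟨g, hg, hg1, j, hj, hgj⟩ := hadj y hy
  have h1 : (x ⊓ 1) ⊔ (y ⊓ 1) ∈ G := by
    rw [inf_comm x, inf_comm y, ← hA.inf_sup]
    exact hGf.inf_mem _ hGf.one_mem _ hxy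
  -- The product is at most `i ⊔ j`, which would put an element of `I` into `G`; `I` need not be
  -- downward closed.
  refine hG.prop.2 _ (hGf.upward _ (hGf.mul_mem _ (hGf.mul_mem _ hf _ hg) _ h1) _ ?_)
    (hI i hi j hj)
  rw [mul_sup]
  exact sup_le_sup ((mul_mono (mul_le_of_le_one_right f hg1) le_rfl).trans hfi)
    ((mul_mono (mul_le_of_le_one_left g hf1) le_rfl).trans hgj)

end Prime

/-! ### Separating a proper subalgebra by two homomorphisms -/

/-- Two distinct homomorphisms into some member of `K` agree on `R`. -/
def IsSeparated (K : Set Alg.{u}) (B : Type u) [ResLattice B] (R : Set B) : Prop :=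
  ∃ C ∈ K, ∃ g h : Hom B C.carrier, (∀ a ∈ R, g.toFun a = h.toFun a) ∧ ∃ b, g.toFun b ≠ h.toFun b

theorem filterQuotient_mem_variety {K : Set Alg.{u}} {B : Type u} [ResLattice B]
    (hB : Alg.mk B ∈ variety K) {F : Set B} (hF : IsDeductiveFilter B F) :
    Alg.mk (FilterQuotient hF) ∈ variety K :=
  variety_of_surjective hB (FilterQuotient.mkHom hF) (FilterQuotient.mk_surjective hF)

section Separation

variable {B : Type u} [ResLattice B] {R F : Set B}

theorem IsSeparated.of_filter {K : Set Alg.{u}} (hB : Alg.mk B ∈ variety K)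
    (hR : IsSubuniverse B R) (hF : IsDeductiveFilter B F) (hRF : ∀ a ∈ R, a ≤ 1 → a ∈ F)
    {c : B} (hc : c ∉ F) : IsSeparated (variety K) B R := by
  have hRF' : ∀ a ∈ R, a ∈ F := fun a ha =>
    (hF.inf_mem_iff.1 (hRF (a ⊓ 1) (hR.inf_mem _ ha _ hR.one_mem) inf_le_right)).1
  refine ⟨_, filterQuotient_mem_variety hB hF, FilterQuotient.mkHom hF, Hom.const _ _,
    fun a ha => ?_, c, fun h => ?_⟩
  · exact (FilterQuotient.mk_eq_one_iff hF).2
      ⟨hRF' a ha, hRF' _ (hR.res_mem _ ha _ hR.one_mem)⟩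
  · exact hc ((FilterQuotient.mk_eq_one_iff hF).1 h).1

/-- A rigid chain embeds in two ways into a chain that has one of its elements doubled. -/
theorem IsRigidChain.exists_doubling {D : Type u} [ResLattice D] (hD : IsRigidChain D) {b t p : D}
    (hb : b < 1) (ht : ∀ x, x ≤ t) (hpb : p ≠ b) (hp1 : p ≠ 1) (hpt : p ≠ t) :
    ∃ C ∈ simpleIdempotentChains.{u}, ∃ g h : Hom D C.carrier,
      (∀ x, x ≠ p → g.toFun x = h.toFun x) ∧ g.toFun p ≠ h.toFun p := by
  classical
  let _ : LinearOrder D :=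
    { (inferInstance : Lattice D) with
      le_total := hD.total
      toDecidableLE := Classical.decRel _
      min_def := fun x y => by
        split_ifs with h
        · exact inf_eq_left.2 h
        · exact inf_eq_right.2 ((hD.total x y).resolve_left h)
      max_def := fun x y => by
        split_ifs with h
        · exact sup_eq_right.2 h
        · exact sup_eq_left.2 ((hD.total x y).resolve_left h) }
  -- `L` is `D` with a second copy of `p` just above the first; `φ` picks the lower copy and `ψ` the
  -- upper.
  let L := {q : D ×ₗ Bool // (ofLex q).2 = true → (ofLex q).1 = p}
  let φ : D → L := fun x => ⟨toLex (x, false), by simp⟩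
  let ψ : D → L := fun x => if h : x = p then ⟨toLex (p, true), by simp⟩ else φ x
  have hle : ∀ (x y : D) (i j : Bool) (hi : i = true → x = p) (hj : j = true → y = p),
      (⟨toLex (x, i), hi⟩ : L) ≤ ⟨toLex (y, j), hj⟩ ↔ x < y ∨ x = y ∧ i ≤ j :=
    fun _ _ _ _ _ _ => Prod.Lex.toLex_le_toLex
  have hφ : ∀ x y, φ x ≤ φ y ↔ x ≤ y := fun x y => by
    rw [hle, le_iff_lt_or_eq (a := x)]
    simp
  have hψ : ∀ x y, ψ x ≤ ψ y ↔ x ≤ y := fun x y => by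
    by_cases hx : x = p <;> by_cases hy : y = p
    · rw [hx, hy]
      exact iff_of_true le_rfl le_rfl
    · simp only [ψ, dif_pos hx, dif_neg hy]
      rw [hle, hx, le_iff_lt_or_eq (a := p)]
      simp [Ne.symm hy]
    · simp only [ψ, dif_neg hx, dif_pos hy]
      rw [hle, hy, le_iff_lt_or_eq (a := x)]
      simp [hx]
    · simp only [ψ, dif_neg hx, dif_neg hy]
      exact hφ x y
  have hb' : ∀ q : L, q < φ 1 → q = φ b := by
    rintro ⟨q, hq⟩ h
    obtain ⟨⟨x, i⟩, rfl⟩ := toLex.surjective q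
    have hx : x < 1 := by
      rw [← hD.not_le_iff_lt, le_iff_lt_or_eq]
      intro h1
      refine h.not_ge ((hle _ _ _ _ _ _).2 ?_)
      exact h1.imp_right fun h2 => ⟨h2, Bool.false_le i⟩
    have hxb : x = b := le_antisymm (hD.least x hx b) (hD.least b hb x)
    cases i with
    | false => subst hxb; rfl
    | true => exact absurd ((hq rfl).symm.trans hxb) hpb
  have ht' : ∀ q : L, q ≤ φ t := by
    rintro ⟨q, hq⟩
    obtain ⟨⟨x, i⟩, rfl⟩ := toLex.surjective q
    refine (hle _ _ _ _ _ _).2 ?_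
    cases i with
    | false => exact (ht x).lt_or_eq.imp_right fun h => ⟨h, le_rfl⟩
    | true => exact Or.inl (lt_of_le_of_ne (ht x) fun h => hpt ((hq rfl).symm.trans h))
  have hbe : φ b < φ 1 := by
    rw [← not_le, hφ]
    exact hb.not_ge
  have hψ' : ∀ x, x ≠ p → φ x = ψ x := fun x hx => by simp [ψ, hx]
  have htop : ∀ s : D, (∀ z, z ≤ s) → s = t := fun s hs => le_antisymm (ht s) (hs t)
  let _ := ofLinearOrder L (φ b) (φ 1) (φ t) hbe hb' ht'
  have hL := isRigidChain_ofLinearOrder L (φ b) (φ 1) (φ t) hbe hb' ht'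
  refine ⟨Alg.mk L, ofLinearOrder_mem L _ _ _ hbe hb' ht',
    hD.homOfOrderEmbedding hL φ hφ rfl ?_, hD.homOfOrderEmbedding hL ψ hψ ?_ ?_, hψ', ?_⟩
  · intro s hs
    rw [htop s hs]
    exact ht'
  · exact (hψ' 1 hp1.symm).symm
  · intro s hs
    rw [htop s hs, ← hψ' t hpt.symm]
    exact ht'
  · intro h
    have h' : φ p = ψ p := h
    have h'' : φ p = ⟨toLex (p, true), by simp⟩ := h'.trans (dif_pos rfl)
    simpa [φ] using congrArg (fun q : L => (ofLex q.1).2) h''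

/-- The class of `a` is the bottom and that of `res a a` the top. Both come from `R`, as does the
unit, so the class of `b` avoids all three and may be doubled. -/
theorem IsSeparated.of_prime (hB : IsSemisimpleSemilinear B) (hR : IsSubuniverse B R)
    (hF : IsPrimeDeductiveFilter B F) {a b : B} (haR : a ∈ R) (ha1 : a ≤ 1) (haF : a ∉ F)
    (hb : ∀ x ∈ R, FilterQuotient.mk hF.1 x ≠ FilterQuotient.mk hF.1 b) :
    IsSeparated (variety simpleIdempotentChains.{u}) B R := by
  have hD := hF.isRigidChain hB
  have ha : FilterQuotient.mk hF.1 a < 1 := by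
    refine lt_of_le_of_ne ?_ (mt (FilterQuotient.mk_eq_one_iff_of_le hF.1 ha1).1 haF)
    exact hF.1.mem_of_one_le (one_le_res.2 ha1)
  obtain ⟨C, hC, g, h, hgh, hne⟩ := hD.exists_doubling (p := FilterQuotient.mk hF.1 b)
    (t := FilterQuotient.mk hF.1 (res a a)) ha (fun x => hD.le_res_of_lt ha (FilterQuotient.mk hF.1 a) x)
    (hb a haR).symm (hb 1 hR.one_mem).symm (hb _ (hR.res_mem _ haR _ haR)).symm
  exact ⟨C, subset_variety _ hC, g.comp (FilterQuotient.mkHom hF.1),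
    h.comp (FilterQuotient.mkHom hF.1), fun x hx => hgh _ (hb x hx), b, hne⟩

/-- If a subalgebra meets every class of `F₁` and of `F₂`, and the two filters agree on it, then
the quotient by `F₁` is also an image of the algebra with kernel `F₂`. -/
theorem exists_hom_of_inter_eq {F₁ F₂ : Set B} (hR : IsSubuniverse B R)
    (h₁ : IsDeductiveFilter B F₁) (h₂ : IsDeductiveFilter B F₂)
    (hF : ∀ a ∈ R, a ∈ F₁ ↔ a ∈ F₂)
    (hs : ∀ b, ∃ a ∈ R, FilterQuotient.mk h₂ a = FilterQuotient.mk h₂ b) :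
    ∃ h : Hom B (FilterQuotient h₁), (∀ a ∈ R, h.toFun a = FilterQuotient.mk h₁ a) ∧
      ∀ x y, FilterQuotient.mk h₂ x = FilterQuotient.mk h₂ y → h.toFun x = h.toFun y := by
  choose s hsR hs using hs
  -- Congruence within `R` is decided by residuals in `R`, where the filters agree; so the chosen
  -- representatives do not matter.
  have key : ∀ x ∈ R, ∀ y ∈ R, FilterQuotient.mk h₂ x = FilterQuotient.mk h₂ y →
      FilterQuotient.mk h₁ x = FilterQuotient.mk h₁ y := by
    intro x hx y hy h
    rw [FilterQuotient.mk_eq_iff] at h ⊢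
    rwa [hF _ (hR.res_mem _ hx _ hy), hF _ (hR.res_mem _ hy _ hx)]
  let k₁ := FilterQuotient.mkHom h₁
  let k₂ := FilterQuotient.mkHom h₂
  have hs' : ∀ b, k₂.toFun (s b) = k₂.toFun b := hs
  refine ⟨⟨fun x => k₁.toFun (s x), ?_, ?_, ?_, ?_, ?_⟩, ?_, ?_⟩
  · intro x y
    rw [← k₁.map_mul]
    refine key _ (hsR _) _ (hR.mul_mem _ (hsR x) _ (hsR y)) ?_
    change k₂.toFun _ = k₂.toFun _
    rw [k₂.map_mul, hs', hs', hs', k₂.map_mul]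
  · intro x y
    rw [← k₁.map_res]
    refine key _ (hsR _) _ (hR.res_mem _ (hsR x) _ (hsR y)) ?_
    change k₂.toFun _ = k₂.toFun _
    rw [k₂.map_res, hs', hs', hs', k₂.map_res]
  · intro x y
    rw [← k₁.map_inf]
    refine key _ (hsR _) _ (hR.inf_mem _ (hsR x) _ (hsR y)) ?_
    change k₂.toFun _ = k₂.toFun _
    rw [k₂.map_inf, hs', hs', hs', k₂.map_inf]
  · intro x y
    rw [← k₁.map_sup]
    refine key _ (hsR _) _ (hR.sup_mem _ (hsR x) _ (hsR y)) ?_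
    change k₂.toFun _ = k₂.toFun _
    rw [k₂.map_sup, hs', hs', hs', k₂.map_sup]
  · rw [← k₁.map_one]
    exact key _ (hsR _) _ hR.one_mem (hs 1)
  · intro a ha
    exact key _ (hsR a) _ ha (hs a)
  · intro x y hxy
    exact key _ (hsR x) _ (hsR y) ((hs x).trans (hxy.trans (hs y).symm))

/-- Two prime filters that are separated by `c` but agree on a subalgebra without `c`. -/
theorem exists_primes_inter_eq (hB : IsSemisimpleSemilinear B) (hR : IsSubuniverse B R) {c : B}
    (hc1 : c ≤ 1) (hcR : c ∉ R) :
    ∃ F₁ F₂, IsPrimeDeductiveFilter B F₁ ∧ IsPrimeDeductiveFilter B F₂ ∧ c ∉ F₁ ∧ c ∈ F₂ ∧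
      ∀ a ∈ R, a ∈ F₁ ↔ a ∈ F₂ := by
  have hJ : IsDeductiveFilter B {z | ∃ a ∈ R, c ≤ a ∧ a ≤ z} :=
    { one_mem := ⟨1, hR.one_mem, hc1, le_rfl⟩
      mul_mem := by
        rintro x ⟨a, ha, hca, hax⟩ y ⟨a', ha', hca', hay⟩
        exact ⟨a * a', hR.mul_mem _ ha _ ha', (hB.idem c).ge.trans (mul_mono hca hca'),
          mul_mono hax hay⟩
      inf_mem := by
        rintro x ⟨a, ha, hca, hax⟩ y ⟨a', ha', hca', hay⟩
        exact ⟨a ⊓ a', hR.inf_mem _ ha _ ha', le_inf hca hca', inf_le_inf hax hay⟩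
      upward := by
        rintro x ⟨a, ha, hca, hax⟩ y hxy
        exact ⟨a, ha, hca, hax.trans hxy⟩ }
  obtain ⟨F₁, hF₁, hJF, hcF⟩ := exists_isPrimeDeductiveFilter hB hJ (I := {c})
    (by rintro x rfl y rfl; exact sup_idem _) (by
      rintro x ⟨a, ha, hca, hax⟩ rfl
      exact hcR (le_antisymm hca hax ▸ ha))
  -- The filter generated by `c` and the trace of `F₁` on `R`. It must avoid `R \ F₁`: if `g * c ≤
  -- a`, then `res g a` is an element of `R` above `c`, hence in `F₁`.
  have hG : IsDeductiveFilter B {z | ∃ g ∈ R, g ∈ F₁ ∧ g * c ≤ z} :=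
    { one_mem := ⟨1, hR.one_mem, hF₁.1.one_mem, by rwa [one_mul]⟩
      mul_mem := by
        rintro x ⟨a, ha, haF, hax⟩ y ⟨a', ha', haF', hay⟩
        refine ⟨a * a', hR.mul_mem _ ha _ ha', hF₁.1.mul_mem _ haF _ haF', ?_⟩
        rw [← hB.idem c, mul_mul_mul_comm]
        exact mul_mono hax hay
      inf_mem := by
        rintro x ⟨a, ha, haF, hax⟩ y ⟨a', ha', haF', hay⟩
        exact ⟨a ⊓ a', hR.inf_mem _ ha _ ha', hF₁.1.inf_mem _ haF _ haF',
          le_inf ((mul_mono inf_le_left le_rfl).trans hax)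
            ((mul_mono inf_le_right le_rfl).trans hay)⟩
      upward := by
        rintro x ⟨a, ha, haF, hax⟩ y hxy
        exact ⟨a, ha, haF, hax.trans hxy⟩ }
  obtain ⟨F₂, hF₂, hGF, hd⟩ := exists_isPrimeDeductiveFilter hB hG (I := {a | a ∈ R ∧ a ∉ F₁})
    (by
      rintro x ⟨hx, hxF⟩ y ⟨hy, hyF⟩
      exact ⟨hR.sup_mem _ hx _ hy, hF₁.2 _ hxF _ hyF⟩) (by
      rintro a ⟨g, hg, hgF, hga⟩ ⟨ha, haF⟩
      have : res g a ∈ F₁ := hJF ⟨_, hR.res_mem _ hg _ ha, le_res_iff.2 hga, le_rfl⟩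
      exact haF (hF₁.1.upward _ (hF₁.1.mul_mem _ hgF _ this) _ (mul_res_le _ _)))
  refine ⟨F₁, F₂, hF₁, hF₂, fun h => hcF c h rfl,
    hGF ⟨1, hR.one_mem, hF₁.1.one_mem, (one_mul c).le⟩, fun a ha => ⟨fun haF => ?_, fun haF => ?_⟩⟩
  · exact hGF ⟨a, ha, haF, mul_le_of_le_one_right a hc1⟩
  · by_contra hn
    exact hd a haF ⟨ha, hn⟩

theorem IsSeparated.of_le_one_notMem
    (hV : Alg.mk B ∈ variety simpleIdempotentChains.{u}) (hR : IsSubuniverse B R) {c : B}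
    (hc1 : c ≤ 1) (hcR : c ∉ R) : IsSeparated (variety simpleIdempotentChains.{u}) B R := by
  have hB : IsSemisimpleSemilinear B := isSemisimpleSemilinear_of_mem_variety hV
  obtain ⟨F₁, F₂, hF₁, hF₂, hc₁, hc₂, hF⟩ := exists_primes_inter_eq hB hR hc1 hcR
  by_cases hRF : ∀ a ∈ R, a ≤ 1 → a ∈ F₁
  · exact IsSeparated.of_filter hV hR hF₁.1 hRF hc₁
  push Not at hRF
  obtain ⟨a, haR, ha1, haF⟩ := hRF
  by_cases hs : ∀ b, ∃ x ∈ R, FilterQuotient.mk hF₂.1 x = FilterQuotient.mk hF₂.1 b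
  · obtain ⟨h, hh, hk⟩ := exists_hom_of_inter_eq hR hF₁.1 hF₂.1 hF hs
    refine ⟨_, filterQuotient_mem_variety hV hF₁.1, FilterQuotient.mkHom hF₁.1, h,
      fun x hx => (hh x hx).symm, c, fun he => hc₁ ?_⟩
    -- `h` factors through the quotient by `F₂`, which contains `c`, so it sends `c` to the unit;
    -- the quotient by `F₁` does not.
    have h1 : h.toFun c = h.toFun 1 :=
      hk c 1 ((FilterQuotient.mk_eq_one_iff_of_le hF₂.1 hc1).2 hc₂)
    rw [h1, h.map_one] at he
    exact (FilterQuotient.mk_eq_one_iff_of_le hF₁.1 hc1).1 he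
  · push Not at hs
    obtain ⟨b, hb⟩ := hs
    exact IsSeparated.of_prime hB hR hF₂ haR ha1 (mt (hF a haR).2 haF) hb

theorem IsSeparated.of_notMem
    (hV : Alg.mk B ∈ variety simpleIdempotentChains.{u}) (hR : IsSubuniverse B R) {b : B}
    (hb : b ∉ R) : IsSeparated (variety simpleIdempotentChains.{u}) B R := by
  have hB : IsSemisimpleSemilinear B := isSemisimpleSemilinear_of_mem_variety hV
  by_cases hneg : ∀ c : B, c ≤ 1 → c ∈ R
  swap
  · push Not at hneg
    obtain ⟨c, hc1, hcR⟩ := hneg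
    exact IsSeparated.of_le_one_notMem hV hR hc1 hcR
  have h1 : IsDeductiveFilter B {x | 1 ≤ x} :=
    { one_mem := le_refl (1 : B)
      mul_mem := fun x hx y hy => (mul_one (1 : B)).ge.trans (mul_mono hx hy)
      inf_mem := fun x hx y hy => le_inf hx hy
      upward := fun x hx y hy => le_trans hx hy }
  -- The set `I` collects the negative `c` modulo which `b` agrees with some element of `R`; a prime
  -- filter avoiding `I` keeps `b` apart from `R`.
  obtain ⟨F, hF, -, hd⟩ := exists_isPrimeDeductiveFilter hB h1
    (I := {c | c ≤ 1 ∧ ∃ a ∈ R, a * c ≤ b ∧ b * c ≤ a}) (by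
      rintro c ⟨hc, a, ha, hab, hba⟩ c' ⟨hc', a', ha', hab', hba'⟩
      -- The new witness lies in `R` because `R` contains the negative elements `c` and `c'`.
      refine ⟨sup_le hc hc', a * c ⊔ a' * c', hR.sup_mem _ (hR.mul_mem _ ha _ (hneg c hc)) _
        (hR.mul_mem _ ha' _ (hneg c' hc')), ?_, ?_⟩
      · exact (mul_le_of_le_one_right _ (sup_le hc hc')).trans (sup_le hab hab')
      · rw [mul_sup]
        refine sup_le_sup ?_ ?_
        -- Idempotence gives `b * c = (b * c) * c ≤ a * c`.
        · rw [← hB.idem c, ← mul_assoc, hB.idem]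
          exact mul_mono hba le_rfl
        · rw [← hB.idem c', ← mul_assoc, hB.idem]
          exact mul_mono hba' le_rfl) (by
      rintro c hc ⟨hc', a, ha, hab, hba⟩
      have hc1 : c = 1 := le_antisymm hc' hc
      rw [hc1, mul_one] at hab hba
      exact hb (le_antisymm hab hba ▸ ha))
  have key : ∀ a ∈ R, res a b ⊓ res b a ⊓ 1 ∉ F := fun a ha h =>
    hd _ h ⟨inf_le_right, a, ha, le_res_iff.1 (inf_le_left.trans inf_le_left),
      le_res_iff.1 (inf_le_left.trans inf_le_right)⟩
  -- `key 1` supplies the negative element of `R` outside `F`.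
  refine IsSeparated.of_prime hB hR hF (b := b) (hneg _ inf_le_right) inf_le_right
    (key 1 hR.one_mem) fun a ha h => key a ha ?_
  rw [FilterQuotient.mk_eq_iff] at h
  exact hF.1.inf_mem _ (hF.1.inf_mem _ h.1 _ h.2) _ hF.1.one_mem

end Separation

/-! ### The claims about the variety. -/

theorem hasSurjectiveEpis_variety_simpleIdempotentChains :
    HasSurjectiveEpis (variety simpleIdempotentChains.{u}) := by
  intro A _ B hB f hf
  by_contra hn
  simp only [Function.Surjective, not_forall] at hn
  obtain ⟨b, hb⟩ := hn
  obtain ⟨C, hC, g, h, hgh, x, hx⟩ := IsSeparated.of_notMem hB f.isSubuniverse_range (b := b) hb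
  exact hx (by rw [hf C hC g h (funext fun a => hgh _ ⟨a, rfl⟩)])

/-- In the chain `0 < 1 < 2 < 3` with unit `1`, the point `2` lies strictly between the unit and the
top. Removing it leaves a subuniverse containing all negative elements. -/
theorem exists_not_isNegativelyGenerated :
    ∃ A ∈ variety simpleIdempotentChains.{u}, ¬ IsNegativelyGenerated A.carrier := by
  let i : Fin 4 → ULift.{u} (Fin 4) := ULift.up
  have hbe : i 0 < i 1 := show (0 : Fin 4) < 1 by decide
  have hb : ∀ x : ULift.{u} (Fin 4), x < i 1 → x = i 0 := by
    rintro ⟨x⟩ hx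
    have hx' : x < 1 := hx
    exact congrArg ULift.up (by omega)
  have ht : ∀ x : ULift.{u} (Fin 4), x ≤ i 3 := by
    rintro ⟨x⟩
    exact Fin.le_last x
  refine ⟨_, subset_variety _ (ofLinearOrder_mem (ULift.{u} (Fin 4)) (i 0) (i 1) (i 3) hbe hb ht),
    fun h => ?_⟩
  let _ := ofLinearOrder (ULift.{u} (Fin 4)) (i 0) (i 1) (i 3) hbe hb ht
  have h2 : i 2 ∈ generated (ULift.{u} (Fin 4)) {a | a ≤ 1} := by
    rw [show generated (ULift.{u} (Fin 4)) {a | a ≤ 1} = Set.univ from h]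
    trivial
  refine (Set.mem_sInter.1 h2 {x | x ≠ i 2} ⟨⟨?_, ?_, ?_, ?_, ?_⟩, ?_⟩) rfl
  · exact fun h => absurd (ULift.up_injective h) (by decide)
  · intro x hx y hy
    change (if x < i 1 ∨ y < i 1 then min x y else max x y) ≠ i 2
    grind
  · intro x hx y hy
    change (if x < i 1 then i 3 else if x ≤ y then y else i 0) ≠ i 2
    have h0 : i 0 ≠ i 2 := fun h => absurd (ULift.up_injective h) (by decide)
    have h3 : i 3 ≠ i 2 := fun h => absurd (ULift.up_injective h) (by decide)
    grind
  · intro x hx y hy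
    change min x y ≠ i 2
    grind
  · intro x hx y hy
    change max x y ≠ i 2
    grind
  · rintro x hx rfl
    have hx' : (2 : Fin 4) ≤ 1 := hx
    exact absurd hx' (by decide)

end ResLattice

theorem mainTheorem12 :
    ResLattice.HasSurjectiveEpis
        (ResLattice.variety ResLattice.simpleIdempotentChains.{u}) ∧
      (∀ A ∈ ResLattice.variety ResLattice.simpleIdempotentChains.{u},
        ResLattice.HasFiniteDepth A.carrier) ∧
      (∃ A ∈ ResLattice.variety ResLattice.simpleIdempotentChains.{u},
        ¬ ResLattice.IsNegativelyGenerated A.carrier) :=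
  ⟨ResLattice.hasSurjectiveEpis_variety_simpleIdempotentChains,
    fun _ hA => (ResLattice.isSemisimpleSemilinear_of_mem_variety hA).hasFiniteDepth,
    ResLattice.exists_not_isNegativelyGenerated⟩
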